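/- A discrete $m$-function is a function $m(z)=\int\frac{d\rho(x)}{x-z}$ on $\mathbb C_+=\{\operatorname{Im} z>0\}$, with $\rho$ a compactly supported probability measure on $\mathbb R$. Its continued fraction coefficients are the bounded sequence of pairs $(a_n,b_n)_{n\ge1}$, $a_n>0$, $b_n\in\mathbb R$, with $$m(z)=\cfrac{1}{b_1-z-\cfrac{a_1^2}{b_2-z-\cfrac{a_2^2}{b_3-z-\cdots}}}\qquad(z\in\mathbb C_+).$$ For sequences $(c_n)_{n\ge1}$ in $(0,\infty)$ and $(d_n)_{n\ge1}$ in $\mathbb R$ define polynomials by $p_{-1}=0$, $p_0=1$, $zp_n=c_{n+1}p_{n+1}+d_{n+1}p_n+c_np_{n-1}$ for $n\ge 0$ (the term $c_np_{n-1}$ being absent for $n=0$), and put $q_0=0$, $q_n(z)=\frac1{c_1}p_{n-1}(z;\{c_j,d_j\}_{j=2}^{n})$ for $n\ge1$. A sequence of pairs $(a_n,b_n)_{n\ge1}$ is doubly palindromic with period $P$ and first length $\ell$, where $1\le\ell<P-1$, if it is purely periodic with period $P$ (that is, $(a_{n+P},b_{n+P})=(a_n,b_n)$ for all $n\ge1$),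 each of $a_1\cdots a_\ell$ and $a_{\ell+1}\cdots a_P$ is a palindrome, and each of $b_1\cdots b_{\ell+1}$ and $b_{\ell+2}\cdots b_P$ is a palindrome. Theorem. Let $M$ be a discrete $m$-function whose continued fraction coefficients $(a_n,b_n)_{n\ge1}$ are eventually periodic: for some $k,p\ge1$, $(a_{n+p},b_{n+p})=(a_n,b_n)$ for all $n>k$, the division being chosen so that also $(a_k,b_k)=(a_{k+p},b_{k+p})$. Let $\alpha,\beta,\gamma\in\mathbb R[z]$, $\alpha\ne0$, satisfy $\alpha M^2+\beta M+\gamma=0$ on $\mathbb C_+$, and let $\widetilde M$ be the second solution of $\alpha y^2+\beta y+\gamma=0$, so that $\alpha y^2+\beta y+\gamma=\alpha(y-M)(y-\widetilde M)$ (as meromorphic functions on $\mathbb C_+$). Suppose that there are a sequence $(c_n,d_n)_{n\ge1}$ with $c_n>0$, $d_n\in\mathbb R$, and an integer $L\ge1$ such that, as an identity of meromorphic functions on $\mathbb C_+$, $$M(z)=\frac{p_L(z)\,\frac{1}{a_k^2\widetilde M(z)}+q_L(z)}{-c_L\left(p_{L-1}(z)\,\frac{1}{a_k^2\widetilde M(z)}+q_{L-1}(z)\right)},$$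 where $p_L,q_L,p_{L-1},q_{L-1}$ are built from $(c_n,d_n)$. Then the continued fraction coefficients of $M$ are purely periodic with period $p$ and doubly palindromic: for some $r\ge1$ and some $\ell$, the sequence $(a_n,b_n)_{n\ge1}$ is doubly palindromic with period $rp$ and first length $\ell$. -/

import Mathlib

open Filter Topology MeasureTheory

/-- `m` is a discrete m-function: on the open upper half-plane it is the Cauchy transform of a
compactly supported probability measure on the real line. -/
def IsDiscreteMFunction (m : ℂ → ℂ) : Prop :=
  ∃ ρ : Measure ℝ, IsProbabilityMeasure ρ ∧ (∃ t : ℝ, ρ (Set.Icc (-t) t)ᶜ = 0) ∧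
    ∀ z : ℂ, 0 < z.im → m z = ∫ x : ℝ, 1 / ((x : ℂ) - z) ∂ρ

/-- `cfApprox a b z n j` is the truncated continued fraction with `n` levels which starts at the
index `j`, namely `1 / (b j - z - a j ^ 2 / (b (j + 1) - z - ⋯ / (b (j + n - 1) - z)))`. -/
noncomputable def cfApprox (a b : ℕ → ℝ) (z : ℂ) : ℕ → ℕ → ℂ
  | 0, _ => 0
  | n + 1, j => 1 / ((b j : ℂ) - z - (a j : ℂ) ^ 2 * cfApprox a b z n (j + 1))

/-- The pairs `(a n, b n)`, `n ≥ 1`, are the continued fraction coefficients of `m`: they are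
bounded, every `a n` is positive, and the infinite continued fraction converges to `m z` for every
`z` in the open upper half-plane. Sequences start at the index `1`; the values `a 0`, `b 0` play no
role anywhere. -/
def HasCFCoefficients (m : ℂ → ℂ) (a b : ℕ → ℝ) : Prop :=
  (∀ n, 1 ≤ n → 0 < a n) ∧ (∃ R : ℝ, ∀ n, 1 ≤ n → a n ≤ R ∧ |b n| ≤ R) ∧
    ∀ z : ℂ, 0 < z.im → Tendsto (fun n => cfApprox a b z n 1) atTop (𝓝 (m z))

/-- The polynomials `p_n` generated by the coefficients `(a_j, b_j)`, `1 ≤ j ≤ n`, through `p_0 = 1`,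
`p_{-1} = 0` and `z p_n = a_{n+1} p_{n+1} + b_{n+1} p_n + a_n p_{n-1}`. -/
noncomputable def orthPoly (a b : ℕ → ℝ) : ℕ → Polynomial ℝ
  | 0 => 1
  | 1 => Polynomial.C (a 1)⁻¹ * (Polynomial.X - Polynomial.C (b 1))
  | n + 2 => Polynomial.C (a (n + 2))⁻¹ *
      ((Polynomial.X - Polynomial.C (b (n + 2))) * orthPoly a b (n + 1)
        - Polynomial.C (a (n + 1)) * orthPoly a b n)

/-- The second kind polynomials: `q_0 = 0`, and `q_n` is `1 / a_1` times the polynomial `p_{n-1}`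
of the coefficients from which the first pair has been removed. -/
noncomputable def secondKindPoly (a b : ℕ → ℝ) : ℕ → Polynomial ℝ
  | 0 => 0
  | n + 1 => Polynomial.C (a 1)⁻¹ * orthPoly (fun j => a (j + 1)) (fun j => b (j + 1)) n

/-- On the upper half-plane `M` solves the quadratic equation `A y ^ 2 + B y + C = 0` with
polynomial coefficients and `A ≠ 0`, and `Mt` is the second solution of that equation, counted with
multiplicity. Like a meromorphic function, `Mt` is only determined away from the zeros of `A`. -/
def IsSecondSolution (A B C : Polynomial ℝ) (M Mt : ℂ → ℂ) : Prop :=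
  A ≠ 0 ∧
  (∀ z : ℂ, 0 < z.im →
    Polynomial.aeval z A * M z ^ 2 + Polynomial.aeval z B * M z + Polynomial.aeval z C = 0) ∧
  ∀ z : ℂ, 0 < z.im → Polynomial.aeval z A ≠ 0 → ∀ y : ℂ,
    Polynomial.aeval z A * y ^ 2 + Polynomial.aeval z B * y + Polynomial.aeval z C
      = Polynomial.aeval z A * (y - M z) * (y - Mt z)

/-- The string `x (s + 1), …, x (s + len)` is a palindrome. -/
def IsPalindromeAt (x : ℕ → ℝ) (s len : ℕ) : Prop :=
  ∀ i j, 1 ≤ i → 1 ≤ j → i + j = len + 1 → x (s + i) = x (s + j)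

/-- The sequence of pairs `(a n, b n)`, `n ≥ 1`, is purely periodic with period `p`. -/
def IsPurelyPeriodic (p : ℕ) (a b : ℕ → ℝ) : Prop :=
  1 ≤ p ∧ ∀ n, 1 ≤ n → a (n + p) = a n ∧ b (n + p) = b n

/-- The sequence of pairs is doubly palindromic with period `p` and first length `l`: all four
palindromes are nonempty. -/
def IsDoublyPalindromic (p l : ℕ) (a b : ℕ → ℝ) : Prop :=
  IsPurelyPeriodic p a b ∧ 1 ≤ l ∧ l + 1 < p ∧
    IsPalindromeAt a 0 l ∧ IsPalindromeAt a l (p - l) ∧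
    IsPalindromeAt b 0 (l + 1) ∧ IsPalindromeAt b (l + 1) (p - l - 1)

/-!
Everything happens in germs along the ray `z = i y`, `y → ∞`. The argument has the shape of Galois'
theorem on purely periodic continued fractions. Let `m j` be the tails of `M = m 1`, so that
`m j = 1 / (b j - z - a j ^ 2 * m (j + 1))`.

* `M` is irrational (`irrational`), so its quadratic equation is unique up to a factor, and every
  rational relation for `M` holds for the second solution `Mt` too. In particular `Mt` has conjugate
  tails `mt j`, and `m k = m (k + p)` gives `mt k = mt (k + p)` (`conjugate_tails_eq`).
* Reading the recursion for `mt` backwards, `h j = 1 / (a j ^ 2 * mt (j + 1))` satisfies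
  `h j = 1 / (b j - z - a (j - 1) ^ 2 * h (j - 1))`. The hypothesis on `M` says that
  `h 0 = 1 / (a k ^ 2 * Mt)` is the continued fraction with the coefficients
  `(c 1, d 1), …, (c L, d L)` followed by those of `M` (`eq_of_poly_relation`). Hence all the `h j`
  and all the `m j` belong to a single continued fraction indexed by `ℤ` (`IsTwoSidedCF`), with
  coefficients `E`, `F` which are `a`, `b` on the right, `c`, `d` in the middle and `a`, `b` in
  reverse order on the left.
* Its members all behave like `-1 / z`, so their coefficients are determined by their germs
  (`IsTwoSidedCF.coeff_eq`). Now `mt k = mt (k + p)` says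
  `E (k - 1) ^ 2 * h (k - 1) = E (k + p - 1) ^ 2 * h (k + p - 1)`, which makes `E` and `F` periodic
  to the left of `k + p`, and hence on all of `ℤ`.
* Periodicity on `ℤ` gives the pure periodicity of `a`, `b`; moreover `E (-L - j) = E j` and
  `F (1 - L - j) = F j` for `j ≥ 1`, and these reflections are the palindromes
  (`isDoublyPalindromic_of_symmetric`).
-/

/-! ### Germs along the imaginary axis -/

/-- The point `i y` of the imaginary axis; germs are taken along this ray as `y → ∞`. -/
noncomputable def ray (y : ℝ) : ℂ := y * Complex.I

/-- `g` behaves like `-1 / z` at `i ∞`, as Cauchy transforms of probability measures do. -/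
def IsNormalized (g : ℝ → ℂ) : Prop := Tendsto (fun y => ray y * g y) atTop (𝓝 (-1))

lemma ray_im (y : ℝ) : (ray y).im = y := by simp [ray]

lemma ray_ne_zero {y : ℝ} (hy : 0 < y) : ray y ≠ 0 := by
  simp [ray, hy.ne']

lemma norm_ray {y : ℝ} (hy : 0 < y) : ‖ray y‖ = y := by
  simp [ray, abs_of_pos hy]

lemma tendsto_inv_ray : Tendsto (fun y => (ray y)⁻¹) atTop (𝓝 0) := by
  rw [tendsto_zero_iff_norm_tendsto_zero]
  refine tendsto_inv_atTop_zero.congr' ?_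
  filter_upwards [eventually_gt_atTop 0] with y hy
  rw [norm_inv, norm_ray hy]

lemma IsNormalized.tendsto_zero {g : ℝ → ℂ} (hg : IsNormalized g) :
    Tendsto g atTop (𝓝 0) := by
  have h := tendsto_inv_ray.mul hg
  rw [zero_mul] at h
  refine h.congr' ?_
  filter_upwards [eventually_gt_atTop 0] with y hy
  rw [inv_mul_cancel_left₀ (ray_ne_zero hy)]

/-! ### Germs of continued fractions at infinity -/

lemma IsNormalized.inv_step {g : ℝ → ℂ} (hg : IsNormalized g) (e f : ℝ) :
    IsNormalized (fun y => 1 / ((f : ℂ) - ray y - (e : ℂ) ^ 2 * g y)) ∧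
    ∀ᶠ y in atTop, 1 / ((f : ℂ) - ray y - (e : ℂ) ^ 2 * g y) *
      ((f : ℂ) - ray y - (e : ℂ) ^ 2 * g y) = 1 := by
  have h : Tendsto (fun y => ((f : ℂ) - ray y - (e : ℂ) ^ 2 * g y) * (ray y)⁻¹) atTop (𝓝 (-1)) := by
    have h1 : Tendsto (fun y => ((f : ℂ) - (e : ℂ) ^ 2 * g y) * (ray y)⁻¹ - 1) atTop
        (𝓝 (((f : ℂ) - (e : ℂ) ^ 2 * 0) * 0 - 1)) :=
      ((tendsto_const_nhds.sub (tendsto_const_nhds.mul hg.tendsto_zero)).mul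
        tendsto_inv_ray).sub tendsto_const_nhds
    rw [mul_zero, zero_sub] at h1
    refine h1.congr' ?_
    filter_upwards [eventually_gt_atTop 0] with y hy
    have := ray_ne_zero hy
    field_simp
    ring
  constructor
  · have h2 := h.inv₀ (by norm_num)
    rw [inv_neg, inv_one] at h2
    refine h2.congr fun y => ?_
    simp only [mul_inv, inv_inv, one_div]
    exact mul_comm _ _
  · filter_upwards [h.eventually_ne (by norm_num : (-1 : ℂ) ≠ 0)] with y hy
    exact one_div_mul_cancel (left_ne_zero_of_mul hy)

lemma IsNormalized.eq_of_sq_mul_eq {g g' : ℝ → ℂ} (hg : IsNormalized g) (hg' : IsNormalized g')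
    {e e' : ℝ} (he : 0 < e) (he' : 0 < e')
    (h : ∀ᶠ y in atTop, (e : ℂ) ^ 2 * g y = (e' : ℂ) ^ 2 * g' y) : e = e' ∧ g =ᶠ[atTop] g' := by
  have h1 : Tendsto (fun y => ray y * ((e : ℂ) ^ 2 * g y)) atTop (𝓝 ((e : ℂ) ^ 2 * (-1))) :=
    (hg.const_mul ((e : ℂ) ^ 2)).congr fun y => by ring
  have h2 : Tendsto (fun y => ray y * ((e : ℂ) ^ 2 * g y)) atTop (𝓝 ((e' : ℂ) ^ 2 * (-1))) := by
    refine (hg'.const_mul ((e' : ℂ) ^ 2)).congr' ?_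
    filter_upwards [h] with y hy
    rw [hy]; ring
  have h3 : (e : ℂ) ^ 2 = (e' : ℂ) ^ 2 := by
    simpa using tendsto_nhds_unique h1 h2
  have h4 : e = e' := by
    have : e ^ 2 = e' ^ 2 := by exact_mod_cast h3
    exact (sq_eq_sq₀ he.le he'.le).1 this
  refine ⟨h4, ?_⟩
  filter_upwards [h] with y hy
  rw [h3] at hy
  exact mul_left_cancel₀ (pow_ne_zero 2 (by exact_mod_cast he'.ne')) hy

/-- The first pair of coefficients and the germ of the remaining continued fraction can be read off
from the behaviour at `i ∞`. -/
lemma IsNormalized.step_unique {g g' k k' : ℝ → ℂ} (hg : IsNormalized g) (hg' : IsNormalized g')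
    {e e' f f' : ℝ} (he : 0 < e) (he' : 0 < e')
    (h : ∀ᶠ y in atTop, k y * ((f : ℂ) - ray y - (e : ℂ) ^ 2 * g y) = 1)
    (h' : ∀ᶠ y in atTop, k' y * ((f' : ℂ) - ray y - (e' : ℂ) ^ 2 * g' y) = 1)
    (hk : k =ᶠ[atTop] k') : f = f' ∧ e = e' ∧ g =ᶠ[atTop] g' := by
  have h1 : ∀ᶠ y in atTop, (e : ℂ) ^ 2 * g y - (e' : ℂ) ^ 2 * g' y = f - f' := by
    filter_upwards [h, h', hk] with y h1 h2 h3
    rw [← h3] at h2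
    have := mul_left_cancel₀ (left_ne_zero_of_mul_eq_one h1) (h1.trans h2.symm)
    linear_combination -this
  have h2 : Tendsto (fun y => (e : ℂ) ^ 2 * g y - (e' : ℂ) ^ 2 * g' y) atTop
      (𝓝 ((e : ℂ) ^ 2 * 0 - (e' : ℂ) ^ 2 * 0)) :=
    (hg.tendsto_zero.const_mul _).sub (hg'.tendsto_zero.const_mul _)
  have h3 := tendsto_nhds_unique (tendsto_const_nhds.congr' (h1.mono fun y hy => hy.symm)) h2
  have h4 : (f : ℂ) = f' := by linear_combination h3
  refine ⟨by exact_mod_cast h4, hg.eq_of_sq_mul_eq hg' he he' ?_⟩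
  filter_upwards [h1] with y hy
  linear_combination hy + h4

/-- A two-sided continued fraction: the germs `h i` satisfy
`h i = 1 / (F i - z - E (i - 1) ^ 2 * h (i - 1))`, so that `h i` has the coefficients
`(E (i - 1), F i), (E (i - 2), F (i - 1)), …`. -/
structure IsTwoSidedCF (E F : ℤ → ℝ) (h : ℤ → ℝ → ℂ) : Prop where
  pos : ∀ i, 0 < E i
  normalized : ∀ i, IsNormalized (h i)
  step : ∀ i, ∀ᶠ y in atTop, h i y * ((F i : ℂ) - ray y - (E (i - 1) : ℂ) ^ 2 * h (i - 1) y) = 1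

lemma IsTwoSidedCF.coeff_eq {E F : ℤ → ℝ} {h : ℤ → ℝ → ℂ} (H : IsTwoSidedCF E F h) {i j : ℤ}
    (hij : h i =ᶠ[atTop] h j) (n : ℕ) :
    F (i - n) = F (j - n) ∧ E (i - 1 - n) = E (j - 1 - n) := by
  have key : ∀ n : ℕ, h (i - n) =ᶠ[atTop] h (j - n) := by
    intro n
    induction n with
    | zero => simpa using hij
    | succ n ih =>
      have := ((H.normalized _).step_unique (H.normalized _) (H.pos _) (H.pos _)
        (H.step (i - n)) (H.step (j - n)) ih).2.2
      push_cast
      rwa [← sub_sub, ← sub_sub]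
  have := (H.normalized _).step_unique (H.normalized _) (H.pos _) (H.pos _)
        (H.step (i - n)) (H.step (j - n)) (key n)
  exact ⟨this.1, by rw [sub_right_comm i, sub_right_comm j]; exact this.2.1⟩

/-- A one-sided continued fraction, placed at the indices `≤ i₀`, extends upwards to a two-sided one
with arbitrary further coefficients. -/
lemma exists_isTwoSidedCF (E F : ℤ → ℝ) (hE : ∀ i, 0 < E i) (i₀ : ℤ) (m : ℕ → ℝ → ℂ)
    (hm : ∀ n, IsNormalized (m n))
    (hstep : ∀ n : ℕ, ∀ᶠ y in atTop,
      m n y * ((F (i₀ - n) : ℂ) - ray y - (E (i₀ - n - 1) : ℂ) ^ 2 * m (n + 1) y) = 1) :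
    ∃ h : ℤ → ℝ → ℂ, IsTwoSidedCF E F h ∧ ∀ n : ℕ, h (i₀ - n) = m n := by
  let G : ℕ → ℝ → ℂ := fun n => Nat.rec (m 0)
    (fun n g y => 1 / ((F (i₀ + n + 1) : ℂ) - ray y - (E (i₀ + n) : ℂ) ^ 2 * g y)) n
  have G0 : G 0 = m 0 := rfl
  have Gs : ∀ n, G (n + 1) =
      fun y => 1 / ((F (i₀ + n + 1) : ℂ) - ray y - (E (i₀ + n) : ℂ) ^ 2 * G n y) := fun n => rfl
  have GN : ∀ n, IsNormalized (G n) := by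
    intro n
    induction n with
    | zero => exact hm 0
    | succ n ih => rw [Gs]; exact (ih.inv_step _ _).1
  let h : ℤ → ℝ → ℂ := fun i => if i ≤ i₀ then m (i₀ - i).toNat else G (i - i₀).toNat
  have hlow : ∀ n : ℕ, h (i₀ - n) = m n := by
    intro n
    simp [h]
  have hhigh : ∀ n : ℕ, h (i₀ + n) = G n := by
    intro n
    rcases Nat.eq_zero_or_pos n with rfl | hn
    · simp [h, G0]
    · simp [h, hn.ne']
  refine ⟨h, ⟨hE, fun i => ?_, fun i => ?_⟩, hlow⟩
  · rcases le_total i i₀ with hi | hi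
    · obtain ⟨n, rfl⟩ : ∃ n : ℕ, i = i₀ - n := ⟨(i₀ - i).toNat, by omega⟩
      rw [hlow]; exact hm n
    · obtain ⟨n, rfl⟩ : ∃ n : ℕ, i = i₀ + n := ⟨(i - i₀).toNat, by omega⟩
      rw [hhigh]; exact GN n
  · rcases le_or_gt i i₀ with hi | hi
    · obtain ⟨n, rfl⟩ : ∃ n : ℕ, i = i₀ - n := ⟨(i₀ - i).toNat, by omega⟩
      have e : h (i₀ - n - 1) = m (n + 1) := by
        rw [← hlow (n + 1)]; congr 1; push_cast; ring
      rw [hlow, e]; exact hstep n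
    · obtain ⟨n, rfl⟩ : ∃ n : ℕ, i = i₀ + n + 1 := ⟨(i - i₀ - 1).toNat, by omega⟩
      have e : h (i₀ + n + 1) = G (n + 1) := by
        rw [← hhigh (n + 1)]; congr 1; push_cast; ring
      rw [e, add_sub_cancel_right, hhigh, Gs]
      exact ((GN n).inv_step _ _).2

/-! ### The tails of the continued fraction -/

lemma cfApprox_bounds (a b : ℕ → ℝ) {z : ℂ} (hz : 0 < z.im) (n j : ℕ) :
    0 ≤ (cfApprox a b z n j).im ∧ ‖cfApprox a b z n j‖ ≤ 1 / z.im ∧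
      ((b j : ℂ) - z - (a j : ℂ) ^ 2 * cfApprox a b z n (j + 1)) ≠ 0 := by
  induction n generalizing j with
  | zero =>
    refine ⟨by simp [cfApprox], by simp [cfApprox, hz.le], fun h => ?_⟩
    have := congrArg Complex.im h
    simp [cfApprox] at this
    exact hz.ne' this
  | succ n ih =>
    -- `Im (b - z - a² g) ≤ -Im z` as soon as `Im g ≥ 0`
    have him : ∀ (j : ℕ) (g : ℂ), 0 ≤ g.im →
        ((b j : ℂ) - z - (a j : ℂ) ^ 2 * g).im ≤ -z.im := by
      intro j g hg
      have : ((b j : ℂ) - z - (a j : ℂ) ^ 2 * g).im = -z.im - a j ^ 2 * g.im := by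
        rw [← Complex.ofReal_pow, Complex.sub_im, Complex.im_ofReal_mul]
        simp
      rw [this]
      nlinarith [mul_nonneg (sq_nonneg (a j)) hg]
    have h1 := him j _ (ih (j + 1)).1
    have h0 : 0 ≤ (cfApprox a b z (n + 1) j).im := by
      rw [cfApprox, one_div, Complex.inv_im]
      exact div_nonneg (by linarith) (Complex.normSq_nonneg _)
    refine ⟨h0, ?_, fun h => ?_⟩
    · rw [cfApprox, norm_div, norm_one]
      refine one_div_le_one_div_of_le hz (le_trans ?_ (Complex.abs_im_le_norm _))
      rw [abs_of_neg (by linarith)]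
      linarith
    · have h2 := him j (cfApprox a b z (n + 1) (j + 1)) (by
        rw [cfApprox, one_div, Complex.inv_im]
        exact div_nonneg (by linarith [him (j + 1) _ (ih (j + 2)).1]) (Complex.normSq_nonneg _))
      rw [h, Complex.zero_im] at h2
      linarith

lemma cfApprox_mul (a b : ℕ → ℝ) {z : ℂ} (hz : 0 < z.im) (n j : ℕ) :
    cfApprox a b z (n + 1) j *
      ((b j : ℂ) - z - (a j : ℂ) ^ 2 * cfApprox a b z n (j + 1)) = 1 := by
  rw [cfApprox]
  exact one_div_mul_cancel (cfApprox_bounds a b hz n j).2.2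

lemma cfApprox_tail_tendsto {a b : ℕ → ℝ} (ha : ∀ n, 1 ≤ n → 0 < a n) {z l : ℂ} (hz : 0 < z.im)
    (h : Tendsto (fun n => cfApprox a b z n 1) atTop (𝓝 l)) (j : ℕ) :
    ∃ l, Tendsto (fun n => cfApprox a b z n (j + 1)) atTop (𝓝 l) := by
  induction j with
  | zero => exact ⟨l, h⟩
  | succ j ih =>
    obtain ⟨l, hl⟩ := ih
    have hl1 := (tendsto_add_atTop_iff_nat 1).2 hl
    have ha0 : (a (j + 1) : ℂ) ≠ 0 := by exact_mod_cast (ha (j + 1) (by omega)).ne'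
    have hne : l ≠ 0 := by
      -- the next approximants are bounded, so passing to the limit in `x * (bounded) = 1`
      rintro rfl
      have hb : Tendsto (fun n => cfApprox a b z (n + 1) (j + 1) *
          ((b (j + 1) : ℂ) - z - (a (j + 1) : ℂ) ^ 2 * cfApprox a b z n (j + 1 + 1)))
          atTop (𝓝 0) := by
        refine hl1.zero_mul_isBoundedUnder_le ?_
        refine isBoundedUnder_of
          ⟨‖(b (j + 1) : ℂ) - z‖ + ‖(a (j + 1) : ℂ) ^ 2‖ * (1 / z.im), fun n => ?_⟩
        refine (norm_sub_le _ _).trans ?_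
        rw [norm_mul]
        gcongr
        exact (cfApprox_bounds a b hz n _).2.1
      simp only [cfApprox_mul a b hz] at hb
      exact one_ne_zero (tendsto_nhds_unique tendsto_const_nhds hb)
    refine ⟨((b (j + 1) : ℂ) - z - l⁻¹) / (a (j + 1) : ℂ) ^ 2, ?_⟩
    refine (((tendsto_const_nhds (x := (b (j + 1) : ℂ) - z)).sub (hl1.inv₀ hne)).div_const
      ((a (j + 1) : ℂ) ^ 2)).congr fun n => ?_
    rw [cfApprox, one_div, inv_inv]
    field_simp
    ring

lemma cfApprox_periodic {a b : ℕ → ℝ} {z : ℂ} {k p : ℕ}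
    (hper : ∀ n, k ≤ n → a (n + p) = a n ∧ b (n + p) = b n) (n j : ℕ) (hj : k ≤ j) :
    cfApprox a b z n (j + p) = cfApprox a b z n j := by
  induction n generalizing j with
  | zero => rfl
  | succ n ih =>
    rw [cfApprox, cfApprox, (hper j hj).1, (hper j hj).2, add_right_comm, ih (j + 1) (by omega)]

/-- The germs of the tails `m j`, `j ≥ 1`, of a convergent continued fraction. -/
lemma exists_tails {M : ℂ → ℂ} {a b : ℕ → ℝ} (hcf : HasCFCoefficients M a b) :
    ∃ m : ℕ → ℝ → ℂ, (∀ y, 0 < y → m 1 y = M (ray y)) ∧ (∀ j, 1 ≤ j → IsNormalized (m j)) ∧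
      (∀ j, 1 ≤ j → ∀ y, 0 < y →
        m j y * ((b j : ℂ) - ray y - (a j : ℂ) ^ 2 * m (j + 1) y) = 1) ∧
      ∀ k p, 1 ≤ k → (∀ n, k ≤ n → a (n + p) = a n ∧ b (n + p) = b n) →
        ∀ y, 0 < y → m (k + p) y = m k y := by
  obtain ⟨ha, -, hlim⟩ := hcf
  have hex : ∀ (j : ℕ) (y : ℝ), ∃ l, 1 ≤ j → 0 < y →
      Tendsto (fun n => cfApprox a b (ray y) n j) atTop (𝓝 l) := by
    intro j y
    by_cases h : 1 ≤ j ∧ 0 < y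
    · obtain ⟨i, rfl⟩ : ∃ i, j = i + 1 := ⟨j - 1, by omega⟩
      have hz : 0 < (ray y).im := by rw [ray_im]; exact h.2
      obtain ⟨l, hl⟩ := cfApprox_tail_tendsto ha hz (hlim _ hz) i
      exact ⟨l, fun _ _ => hl⟩
    · exact ⟨0, fun h1 h2 => absurd ⟨h1, h2⟩ h⟩
  choose m hm using hex
  have him : ∀ y : ℝ, 0 < y → 0 < (ray y).im := fun y hy => by rwa [ray_im]
  have hmul : ∀ j, 1 ≤ j → ∀ y, 0 < y →
        m j y * ((b j : ℂ) - ray y - (a j : ℂ) ^ 2 * m (j + 1) y) = 1 := by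
    intro j hj y hy
    have h1 := (tendsto_add_atTop_iff_nat 1).2 (hm j y hj hy)
    have h2 := h1.mul ((tendsto_const_nhds (x := (b j : ℂ) - ray y)).sub
      ((hm (j + 1) y (by omega) hy).const_mul ((a j : ℂ) ^ 2)))
    simp only [cfApprox_mul a b (him y hy)] at h2
    exact (tendsto_nhds_unique tendsto_const_nhds h2).symm
  have hbd : ∀ j, 1 ≤ j → ∀ y, 0 < y → ‖m j y‖ ≤ 1 / y := by
    intro j hj y hy
    refine le_of_tendsto (hm j y hj hy).norm (Eventually.of_forall fun n => ?_)
    have := (cfApprox_bounds a b (him y hy) n j).2.1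
    rwa [ray_im] at this
  have hzero : ∀ j, 1 ≤ j → Tendsto (m j) atTop (𝓝 0) := by
    intro j hj
    refine squeeze_zero_norm' ?_ (tendsto_inv_atTop_zero (𝕜 := ℝ))
    filter_upwards [eventually_gt_atTop 0] with y hy
    rw [← one_div]; exact hbd j hj y hy
  refine ⟨m, fun y hy => tendsto_nhds_unique (hm 1 y le_rfl hy) (hlim _ (him y hy)),
    fun j hj => ?_, hmul, fun k p hk hper y hy => ?_⟩
  · have h1 : Tendsto (fun y => m j y * ((b j : ℂ) - (a j : ℂ) ^ 2 * m (j + 1) y) - 1) atTop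
        (𝓝 (0 * ((b j : ℂ) - (a j : ℂ) ^ 2 * 0) - 1)) :=
      ((hzero j hj).mul (tendsto_const_nhds.sub
        ((hzero (j + 1) (by omega)).const_mul _))).sub tendsto_const_nhds
    rw [zero_mul, zero_sub] at h1
    refine h1.congr' ?_
    filter_upwards [eventually_gt_atTop 0] with y hy
    linear_combination hmul j hj y hy
  · refine tendsto_nhds_unique (hm (k + p) y (by omega) hy) ?_
    refine (hm k y hk hy).congr fun n => ?_
    rw [cfApprox_periodic hper n k le_rfl]

/-! ### Irrationality of the continued fraction -/

open Polynomial in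
lemma tendsto_aeval_ray_div_pow {P : ℝ[X]} {n : ℕ} (hP : P.natDegree ≤ n) :
    Tendsto (fun y => aeval (ray y) P * (ray y)⁻¹ ^ n) atTop (𝓝 (P.coeff n : ℂ)) := by
  have h : ∀ i ∈ Finset.range (n + 1), Tendsto
      (fun y => (P.coeff i : ℂ) * (ray y)⁻¹ ^ (n - i)) atTop
        (𝓝 (if i = n then (P.coeff n : ℂ) else 0)) := by
    intro i hi
    have h1 := (tendsto_inv_ray.pow (n - i)).const_mul (P.coeff i : ℂ)
    rcases eq_or_ne i n with rfl | hin
    · simp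
    · have : i < n + 1 := Finset.mem_range.1 hi
      rw [zero_pow (by omega), mul_zero] at h1
      rwa [if_neg hin]
  have h2 := tendsto_finsetSum _ h
  rw [Finset.sum_ite_eq' (Finset.range (n + 1)) n, if_pos (by simp)] at h2
  refine h2.congr' ?_
  filter_upwards [eventually_gt_atTop 0] with y hy
  rw [aeval_eq_sum_range' (Nat.lt_succ_of_le hP), Finset.sum_mul]
  refine Finset.sum_congr rfl fun i hi => ?_
  have hi' : i ≤ n := Nat.lt_succ_iff.1 (Finset.mem_range.1 hi)
  have hr := ray_ne_zero hy
  rw [Complex.real_smul, mul_assoc]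
  congr 1
  rw [inv_pow, inv_pow]
  obtain ⟨t, rfl⟩ := Nat.exists_eq_add_of_le hi'
  rw [Nat.add_sub_cancel_left, pow_add]
  field_simp

/-- No nontrivial polynomial relation `P * m j + Q = 0` holds, even on an unbounded set of the ray: replacing `m j` by
`m (j + 1)` turns such a relation into one of smaller degree. -/
lemma irrational_aux {a b : ℕ → ℝ} {m : ℕ → ℝ → ℂ} (ha : ∀ n, 1 ≤ n → 0 < a n)
    (hN : ∀ j, 1 ≤ j → IsNormalized (m j))
    (hmul : ∀ j, 1 ≤ j → ∀ y, 0 < y →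
        m j y * ((b j : ℂ) - ray y - (a j : ℂ) ^ 2 * m (j + 1) y) = 1)
    (n : ℕ) : ∀ (j : ℕ) (P Q : Polynomial ℝ), 1 ≤ j → P.natDegree ≤ n → Q.natDegree ≤ n →
      (∃ᶠ y in atTop, Polynomial.aeval (ray y) P * m j y + Polynomial.aeval (ray y) Q = 0) →
      P = 0 ∧ Q = 0 := by
  have top : ∀ (n j : ℕ) (P Q : Polynomial ℝ), 1 ≤ j → P.natDegree ≤ n → Q.natDegree ≤ n →
      (∃ᶠ y in atTop, Polynomial.aeval (ray y) P * m j y + Polynomial.aeval (ray y) Q = 0) →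
      Q.coeff n = 0 := by
    intro n j P Q hj hP hQ h
    have h1 := ((tendsto_aeval_ray_div_pow hP).mul (hN j hj).tendsto_zero).add
      (tendsto_aeval_ray_div_pow hQ)
    rw [mul_zero, zero_add] at h1
    by_contra hne
    have h2 := h1.eventually_ne (by exact_mod_cast hne : (Q.coeff n : ℂ) ≠ 0)
    obtain ⟨y, hy1, hy2⟩ := (h.and_eventually h2).exists
    exact hy2 (by linear_combination (ray y)⁻¹ ^ n * hy1)
  -- the relation satisfied by the next tail
  have next : ∀ (j : ℕ) (P Q : Polynomial ℝ), 1 ≤ j →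
      (∃ᶠ y in atTop, Polynomial.aeval (ray y) P * m j y + Polynomial.aeval (ray y) Q = 0) →
      ∃ᶠ y in atTop, Polynomial.aeval (ray y) (Polynomial.C (-a j ^ 2) * Q) * m (j + 1) y
        + Polynomial.aeval (ray y) (P + Q * (Polynomial.C (b j) - Polynomial.X)) = 0 := by
    intro j P Q hj h
    refine (h.and_eventually (eventually_gt_atTop 0)).mono fun y hy => ?_
    have h1 := hmul j hj y hy.2
    simp only [map_mul, map_add, map_sub, Polynomial.aeval_C, Polynomial.aeval_X,
      Complex.coe_algebraMap, Complex.ofReal_neg, Complex.ofReal_pow]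
    linear_combination ((b j : ℂ) - ray y - (a j : ℂ) ^ 2 * m (j + 1) y) * hy.1
      - Polynomial.aeval (ray y) P * h1
  induction n with
  | zero =>
    intro j P Q hj hP hQ h
    have hQ0 : Q = 0 := by
      rw [Polynomial.eq_C_of_natDegree_le_zero hQ, top 0 j P Q hj hP hQ h, Polynomial.C_0]
    refine ⟨?_, hQ0⟩
    have h2 := next j P Q hj h
    subst hQ0
    have := top 0 (j + 1) 0 P (by omega) (by simp) hP (by simpa using h2)
    rw [Polynomial.eq_C_of_natDegree_le_zero hP, this, Polynomial.C_0]
  | succ n ih =>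
    intro j P Q hj hP hQ h
    have hlt : ∀ R : Polynomial ℝ, R.natDegree ≤ n + 1 → R.coeff (n + 1) = 0 →
        R.natDegree ≤ n := by
      intro R h1 h2
      rcases h1.lt_or_eq with h3 | h3
      · omega
      · rw [← h3, Polynomial.coeff_natDegree, Polynomial.leadingCoeff_eq_zero] at h2
        simp [h2]
    have hQ' := hlt Q hQ (top _ j P Q hj hP hQ h)
    have h2 := next j P Q hj h
    have d1 : (Polynomial.C (-a j ^ 2) * Q).natDegree ≤ n :=
      (Polynomial.natDegree_C_mul_le _ _).trans hQ'
    have d2 : (P + Q * (Polynomial.C (b j) - Polynomial.X)).natDegree ≤ n + 1 := by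
      refine Polynomial.natDegree_add_le_of_degree_le hP ?_
      refine Polynomial.natDegree_mul_le.trans (Nat.add_le_add hQ' ?_)
      refine (Polynomial.natDegree_sub_le _ _).trans ?_
      simp
    have d3 := hlt _ d2 (top _ _ _ _ (by omega) (d1.trans (by omega)) d2 h2)
    obtain ⟨e1, e2⟩ := ih _ _ _ (by omega) d1 d3 h2
    have ha0 : -a j ^ 2 ≠ 0 := neg_ne_zero.2 (pow_ne_zero 2 (ha j hj).ne')
    have hQ0 : Q = 0 := by
      rcases mul_eq_zero.1 e1 with h | h
      · exact absurd (Polynomial.C_eq_zero.1 h) ha0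
      · exact h
    subst hQ0
    exact ⟨by simpa using e2, rfl⟩

lemma irrational {a b : ℕ → ℝ} {m : ℕ → ℝ → ℂ} (ha : ∀ n, 1 ≤ n → 0 < a n)
    (hN : ∀ j, 1 ≤ j → IsNormalized (m j))
    (hmul : ∀ j, 1 ≤ j → ∀ y, 0 < y →
        m j y * ((b j : ℂ) - ray y - (a j : ℂ) ^ 2 * m (j + 1) y) = 1)
    {P Q : Polynomial ℝ}
    (h : ∃ᶠ y in atTop, Polynomial.aeval (ray y) P * m 1 y + Polynomial.aeval (ray y) Q = 0) :
    P = 0 ∧ Q = 0 :=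
  irrational_aux ha hN hmul (max P.natDegree Q.natDegree) 1 P Q le_rfl (le_max_left _ _)
    (le_max_right _ _) h

/-- A nonzero polynomial has no zeros far out on the ray. -/
lemma eventually_aeval_ray_ne_zero {P : Polynomial ℝ} (hP : P ≠ 0) :
    ∀ᶠ y in atTop, Polynomial.aeval (ray y) P ≠ 0 := by
  have h := (tendsto_aeval_ray_div_pow (le_refl P.natDegree)).eventually_ne
    (by exact_mod_cast Polynomial.leadingCoeff_ne_zero.2 hP : (P.coeff P.natDegree : ℂ) ≠ 0)
  exact h.mono fun y hy => left_ne_zero_of_mul hy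

/-! ### The linear relation through the polynomials of first and second kind -/

lemma secondKindPoly_add_two (c d : ℕ → ℝ) (n : ℕ) :
    secondKindPoly c d (n + 2) = Polynomial.C (c (n + 2))⁻¹ *
      ((Polynomial.X - Polynomial.C (d (n + 2))) * secondKindPoly c d (n + 1)
        - Polynomial.C (c (n + 1)) * secondKindPoly c d n) := by
  cases n with
  | zero => simp only [secondKindPoly, orthPoly]; ring
  | succ n => simp only [secondKindPoly, orthPoly]; ring

lemma degree_orthPoly {c : ℕ → ℝ} (d : ℕ → ℝ) (hc : ∀ n, 1 ≤ n → 0 < c n) (n : ℕ) :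
    (orthPoly c d n).degree = n := by
  induction n using Nat.twoStepInduction with
  | zero => simp [orthPoly]
  | one =>
    rw [orthPoly, Polynomial.degree_C_mul (inv_ne_zero (hc 1 le_rfl).ne'),
      Polynomial.degree_X_sub_C, Nat.cast_one]
  | more n h0 h1 =>
    rw [orthPoly, Polynomial.degree_C_mul (inv_ne_zero (hc (n + 2) (by omega)).ne')]
    have h2 : ((Polynomial.X - Polynomial.C (d (n + 2))) * orthPoly c d (n + 1)).degree
        = ((n + 2 : ℕ) : WithBot ℕ) := by
      rw [Polynomial.degree_mul, Polynomial.degree_X_sub_C, h1, ← Nat.cast_one, ← Nat.cast_add]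
      congr 1; ring
    rw [Polynomial.degree_sub_eq_left_of_degree_lt, h2]
    rw [h2, Polynomial.degree_C_mul (hc (n + 1) (by omega)).ne', h0]
    exact_mod_cast (by omega : n < n + 2)

lemma orthPoly_ne_zero {c : ℕ → ℝ} (d : ℕ → ℝ) (hc : ∀ n, 1 ≤ n → 0 < c n) (n : ℕ) :
    orthPoly c d n ≠ 0 := by
  intro h
  have := degree_orthPoly d hc n
  rw [h, Polynomial.degree_zero] at this
  exact WithBot.bot_ne_natCast n this

/-- If `s i` has the coefficients `(c (i + 1), d (i + 1)), …, (c L, d L)` followed by `s L`, then a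
number `w` which the polynomials of first and second kind map to `s L` is `s 0`. The relation
`s n * c n * y (n - 1) + y n = 0` with `y n = p n * w + q n` is carried from `n = L` down to
`n = 1`. -/
lemma eq_of_poly_relation {c d : ℕ → ℝ} (hc : ∀ n, 1 ≤ n → 0 < c n) {z w : ℂ} {s : ℕ → ℂ} {L : ℕ}
    (hs : ∀ i, i ≤ L → s i * ((d (i + 1) : ℂ) - z - (c (i + 1) : ℂ) ^ 2 * s (i + 1)) = 1)
    (h : s (L + 1) * (c (L + 1) * (Polynomial.aeval z (orthPoly c d L) * w
        + Polynomial.aeval z (secondKindPoly c d L)))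
      + (Polynomial.aeval z (orthPoly c d (L + 1)) * w
        + Polynomial.aeval z (secondKindPoly c d (L + 1))) = 0) :
    w = s 0 := by
  induction L with
  | zero =>
    have h1 := hs 0 le_rfl
    have hc1 : (c 1 : ℂ) ≠ 0 := by exact_mod_cast (hc 1 le_rfl).ne'
    simp [orthPoly, secondKindPoly] at h
    field_simp at h
    simp only [zero_add] at h1
    linear_combination -w * h1 - s 0 * h
  | succ L ih =>
    refine ih (fun i hi => hs i (by omega)) ?_
    have h1 := hs (L + 1) le_rfl
    have hc1 : (c (L + 2) : ℂ) ≠ 0 := by exact_mod_cast (hc (L + 2) (by omega)).ne'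
    rw [secondKindPoly_add_two, orthPoly] at h
    simp only [map_mul, map_sub, Polynomial.aeval_C, Polynomial.aeval_X,
      Complex.coe_algebraMap, Complex.ofReal_inv] at h
    field_simp at h
    simp only [add_assoc, Nat.reduceAdd] at h h1 ⊢
    linear_combination (Polynomial.aeval z (orthPoly c d (L + 1)) * w
        + Polynomial.aeval z (secondKindPoly c d (L + 1))) * (-h1) - s (L + 1) * h

/-! ### Conjugate tails -/

/-- The tail number `j + 1` of a continued fraction is a Möbius transform, with polynomial
coefficients that depend only on the first `j` pairs, of the whole. -/
lemma exists_moebius {a b : ℕ → ℝ} (ha : ∀ n, 1 ≤ n → 0 < a n) (j : ℕ) :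
    ∃ u v r t : Polynomial ℝ, ∀ (z : ℂ) (x : ℕ → ℂ),
      (∀ i, i < j → x (i + 1) * ((b (i + 1) : ℂ) - z - (a (i + 1) : ℂ) ^ 2 * x (i + 2)) = 1) →
      Polynomial.aeval z u * x 1 + Polynomial.aeval z v =
        (Polynomial.aeval z r * x 1 + Polynomial.aeval z t) * x (j + 1) ∧
      Polynomial.aeval z r * x 1 + Polynomial.aeval z t ≠ 0 := by
  induction j with
  | zero => exact ⟨1, 0, 0, 1, fun z x _ => by simp⟩
  | succ j ih =>
    obtain ⟨u, v, r, t, h⟩ := ih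
    refine ⟨(Polynomial.C (b (j + 1)) - Polynomial.X) * u - r,
      (Polynomial.C (b (j + 1)) - Polynomial.X) * v - t,
      Polynomial.C (a (j + 1) ^ 2) * u, Polynomial.C (a (j + 1) ^ 2) * v, fun z x hx => ?_⟩
    obtain ⟨h1, h2⟩ := h z x fun i hi => hx i (by omega)
    have h3 := hx j (by omega)
    have ha0 : (a (j + 1) : ℂ) ≠ 0 := by exact_mod_cast (ha (j + 1) (by omega)).ne'
    simp only [map_mul, map_sub, Polynomial.aeval_C, Polynomial.aeval_X,
      Complex.coe_algebraMap, Complex.ofReal_pow]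
    constructor
    · linear_combination ((b (j + 1) : ℂ) - z - (a (j + 1) : ℂ) ^ 2 * x (j + 2)) * h1
        + (Polynomial.aeval z r * x 1 + Polynomial.aeval z t) * h3
    · have : (a (j + 1) : ℂ) ^ 2 * ((Polynomial.aeval z r * x 1 + Polynomial.aeval z t) * x (j + 1))
          ≠ 0 := mul_ne_zero (pow_ne_zero 2 ha0)
            (mul_ne_zero h2 (left_ne_zero_of_mul_eq_one h3))
      rw [← h1] at this
      intro h0
      exact this (by linear_combination h0)

/-- Conjugation: an equality between two tails of `m` passes to the tails of a continued fraction
with the same first coefficients whose value is the second root of the quadratic equation of `m 1`,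
since by irrationality this equation is unique up to a factor. -/
lemma conjugate_tails_eq {a b : ℕ → ℝ} {m mt : ℕ → ℝ → ℂ} (ha : ∀ n, 1 ≤ n → 0 < a n)
    (hN : ∀ j, 1 ≤ j → IsNormalized (m j))
    (hmul : ∀ j, 1 ≤ j → ∀ y, 0 < y →
        m j y * ((b j : ℂ) - ray y - (a j : ℂ) ^ 2 * m (j + 1) y) = 1)
    (hmt : ∀ j, 1 ≤ j → ∀ᶠ y in atTop,
        mt j y * ((b j : ℂ) - ray y - (a j : ℂ) ^ 2 * mt (j + 1) y) = 1)
    {A B C : Polynomial ℝ} (hA : A ≠ 0)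
    (hq : ∀ᶠ y in atTop, Polynomial.aeval (ray y) A * m 1 y ^ 2
      + Polynomial.aeval (ray y) B * m 1 y + Polynomial.aeval (ray y) C = 0)
    (hqt : ∀ᶠ y in atTop, Polynomial.aeval (ray y) A * mt 1 y ^ 2
      + Polynomial.aeval (ray y) B * mt 1 y + Polynomial.aeval (ray y) C = 0)
    {i j : ℕ} (hij : ∀ᶠ y in atTop, m (i + 1) y = m (j + 1) y) :
    ∀ᶠ y in atTop, mt (i + 1) y = mt (j + 1) y := by
  obtain ⟨u, v, r, t, h1⟩ := exists_moebius (b := b) ha i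
  obtain ⟨u', v', r', t', h2⟩ := exists_moebius (b := b) ha j
  have hm1 : ∀ n y, 0 < y → ∀ i < n, m (i + 1) y *
      ((b (i + 1) : ℂ) - ray y - (a (i + 1) : ℂ) ^ 2 * m (i + 2) y) = 1 :=
    fun n y hy i _ => hmul (i + 1) (by omega) y hy
  have hmt1 : ∀ n, ∀ᶠ y in atTop, ∀ i < n, mt (i + 1) y *
      ((b (i + 1) : ℂ) - ray y - (a (i + 1) : ℂ) ^ 2 * mt (i + 2) y) = 1 := fun n =>
    (eventually_all_finite (Set.finite_Iio n)).2 fun i _ => hmt (i + 1) (by omega)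
  obtain ⟨e1, e2⟩ := irrational ha hN hmul
    (P := A * (u * t' + v * r' - u' * t - v' * r) - B * (u * r' - u' * r))
    (Q := A * (v * t' - v' * t) - C * (u * r' - u' * r)) (by
      refine Eventually.frequently ?_
      filter_upwards [hq, hij, eventually_gt_atTop 0] with y hy h3 hy0
      have g1 := (h1 (ray y) (fun n => m n y) (hm1 i y hy0)).1
      have g2 := (h2 (ray y) (fun n => m n y) (hm1 j y hy0)).1
      simp only [map_mul, map_add, map_sub] at g1 g2 ⊢
      rw [h3] at g1
      linear_combination
        Polynomial.aeval (ray y) A * (Polynomial.aeval (ray y) r' * m 1 y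
          + Polynomial.aeval (ray y) t') * g1
        - Polynomial.aeval (ray y) A * (Polynomial.aeval (ray y) r * m 1 y
          + Polynomial.aeval (ray y) t) * g2
        - (Polynomial.aeval (ray y) u * Polynomial.aeval (ray y) r'
          - Polynomial.aeval (ray y) u' * Polynomial.aeval (ray y) r) * hy)
  filter_upwards [hqt, hmt1 i, hmt1 j, eventually_aeval_ray_ne_zero hA] with y hy h3 h4 hA0
  obtain ⟨g1, n1⟩ := h1 (ray y) (fun n => mt n y) h3
  obtain ⟨g2, n2⟩ := h2 (ray y) (fun n => mt n y) h4
  have e1' := congrArg (Polynomial.aeval (ray y)) e1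
  have e2' := congrArg (Polynomial.aeval (ray y)) e2
  simp only [map_mul, map_add, map_sub, map_zero] at e1' e2' g1 g2
  refine mul_left_cancel₀ (mul_ne_zero hA0 (mul_ne_zero n1 n2)) ?_
  linear_combination
    - Polynomial.aeval (ray y) A * (Polynomial.aeval (ray y) r' * mt 1 y
        + Polynomial.aeval (ray y) t') * g1
    + Polynomial.aeval (ray y) A * (Polynomial.aeval (ray y) r * mt 1 y
        + Polynomial.aeval (ray y) t) * g2
    + (Polynomial.aeval (ray y) u * Polynomial.aeval (ray y) r'
        - Polynomial.aeval (ray y) u' * Polynomial.aeval (ray y) r) * hy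
    + mt 1 y * e1' + e2'

/-! ### Symmetric periodic sequences are doubly palindromic -/

lemma isDoublyPalindromic_of_symmetric {a b : ℕ → ℝ} {E F : ℤ → ℝ} {p L : ℕ} (hp : 1 ≤ p)
    (hE : ∀ i, E (i - p) = E i) (hF : ∀ i, F (i - p) = F i)
    (hEa : ∀ j : ℕ, 1 ≤ j → E j = a j) (hFb : ∀ j : ℕ, 1 ≤ j → F j = b j)
    (hEs : ∀ j : ℕ, 1 ≤ j → E (-L - j) = a j) (hFs : ∀ j : ℕ, 1 ≤ j → F (1 - L - j) = b j) :
    IsPurelyPeriodic p a b ∧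
      ∃ r : ℕ, 1 ≤ r ∧ ∃ l : ℕ, IsDoublyPalindromic (r * p) l a b := by
  have per : ∀ G : ℤ → ℝ, (∀ i, G (i - p) = G i) → ∀ (n : ℕ) (i : ℤ), G (i + n * p) = G i := by
    intro G hG n
    induction n with
    | zero => simp
    | succ n ih =>
      intro i
      rw [← ih i, ← hG (i + (n + 1 : ℕ) * p)]
      congr 1; push_cast; ring
  have pera : ∀ n i : ℕ, 1 ≤ i → a (i + n * p) = a i := by
    intro n i hi
    rw [← hEa i hi, ← hEa _ (by omega), ← per E hE n i]
    push_cast; rfl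
  have perb : ∀ n i : ℕ, 1 ≤ i → b (i + n * p) = b i := by
    intro n i hi
    rw [← hFb i hi, ← hFb _ (by omega), ← per F hF n i]
    push_cast; rfl
  have syma : ∀ n i j : ℕ, 1 ≤ i → 1 ≤ j → i + j + L = n * p → a i = a j := by
    intro n i j hi hj h
    rw [← hEs i hi, ← hEa j hj, ← per E hE n]
    congr 1
    have : (i : ℤ) + j + L = n * p := by exact_mod_cast h
    linarith
  have symb : ∀ n i j : ℕ, 1 ≤ i → 1 ≤ j → i + j + L = n * p + 1 → b i = b j := by
    intro n i j hi hj h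
    rw [← hFs i hi, ← hFb j hj, ← per F hF n]
    congr 1
    have : (i : ℤ) + j + L = n * p + 1 := by exact_mod_cast h
    linarith
  refine ⟨⟨hp, fun n hn => ?_⟩, L + 3, by omega, (L + 2) * p - L - 1, ⟨?_, ?_⟩, ?_⟩
  · have h1 := pera 1 n hn
    have h2 := perb 1 n hn
    rw [one_mul] at h1 h2
    exact ⟨h1, h2⟩
  · exact Nat.mul_pos (by omega) hp
  · exact fun n hn => ⟨pera _ n hn, perb _ n hn⟩
  · have h0 : L + 2 ≤ (L + 2) * p := Nat.le_mul_of_pos_right _ hp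
    have h1 : (L + 3) * p = (L + 2) * p + p := by ring
    have h2 : ((L + 2) + (L + 3)) * p = (L + 2) * p + ((L + 2) * p + p) := by ring
    refine ⟨by omega, by omega, fun i j hi hj h => ?_, fun i j hi hj h => ?_,
      fun i j hi hj h => ?_, fun i j hi hj h => ?_⟩
    · exact syma (L + 2) _ _ (by omega) (by omega) (by omega)
    · exact syma ((L + 2) + (L + 3)) _ _ (by omega) (by omega) (by omega)
    · exact symb (L + 2) _ _ (by omega) (by omega) (by omega)
    · exact symb ((L + 2) + (L + 3)) _ _ (by omega) (by omega) (by omega)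

/-! ### The two-sided continued fraction of a self-conjugate function -/

theorem theorem3
    -- the function and its eventually periodic continued fraction coefficients
    (M : ℂ → ℂ) (a b : ℕ → ℝ) (k p : ℕ)
    (hM : IsDiscreteMFunction M) (hcf : HasCFCoefficients M a b)
    (hk : 1 ≤ k) (hp : 1 ≤ p)
    (hper : ∀ n, k < n → a (n + p) = a n ∧ b (n + p) = b n)
    (hlast : a k = a (k + p) ∧ b k = b (k + p))
    -- the second solution of the quadratic equation of the function
    (A B C : Polynomial ℝ) (Mt : ℂ → ℂ) (hMt : IsSecondSolution A B C M Mt)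
    -- the relation, an identity of meromorphic functions: it is only required where
    -- all the expressions in it are finite
    (c d : ℕ → ℝ) (hc : ∀ n, 1 ≤ n → 0 < c n) (L : ℕ) (hL : 1 ≤ L)
    (hrel : ∀ z : ℂ, 0 < z.im → Polynomial.aeval z A ≠ 0 → Mt z ≠ 0 →
      -(c L : ℂ) * (Polynomial.aeval z (orthPoly c d (L - 1)) * (1 / ((a k : ℂ) ^ 2 * Mt z))
          + Polynomial.aeval z (secondKindPoly c d (L - 1))) ≠ 0 →
      M z =
        (Polynomial.aeval z (orthPoly c d L) * (1 / ((a k : ℂ) ^ 2 * Mt z))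
          + Polynomial.aeval z (secondKindPoly c d L)) /
        (-(c L : ℂ) * (Polynomial.aeval z (orthPoly c d (L - 1)) * (1 / ((a k : ℂ) ^ 2 * Mt z))
          + Polynomial.aeval z (secondKindPoly c d (L - 1))))) :
    IsPurelyPeriodic p a b ∧
      ∃ r : ℕ, 1 ≤ r ∧ ∃ l : ℕ, IsDoublyPalindromic (r * p) l a b := by
  have ha := hcf.1
  obtain ⟨m, hm1, hN, hmul, hmper⟩ := exists_tails hcf
  obtain ⟨hA, hMq, hMt⟩ := hMt
  obtain ⟨k, rfl⟩ : ∃ k', k = k' + 1 := ⟨k - 1, by omega⟩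
  obtain ⟨L, rfl⟩ : ∃ L', L = L' + 1 := ⟨L - 1, by omega⟩
  have hper' : ∀ n, k + 1 ≤ n → a (n + p) = a n ∧ b (n + p) = b n := by
    intro n hn
    rcases hn.eq_or_lt with rfl | hn
    · exact ⟨hlast.1.symm, hlast.2.symm⟩
    · exact hper n hn
  -- Downwards: the pairs of `M`, the junction `E 0 = a k`, the pairs `c`, `d`, then those of `M`
  -- in reverse order.
  obtain ⟨E, hE⟩ : ∃ E : ℤ → ℝ, E = fun i => if 1 ≤ i then a i.toNat else if i = 0 then a (k + 1)
    else if -((L + 1 : ℕ) : ℤ) ≤ i then c (-i).toNat else a (-(L + 1 : ℕ) - i).toNat := ⟨_, rfl⟩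
  obtain ⟨F, hF⟩ : ∃ F : ℤ → ℝ, F = fun i => if 1 ≤ i then b i.toNat
    else if 1 - ((L + 1 : ℕ) : ℤ) ≤ i then d (1 - i).toNat else b (1 - (L + 1 : ℕ) - i).toNat :=
    ⟨_, rfl⟩
  have hEa : ∀ j : ℕ, 1 ≤ j → E j = a j := by
    intro j hj
    rw [hE]
    simp only
    rw [if_pos (by omega), Int.toNat_natCast]
  have hE0 : E 0 = a (k + 1) := by simp [hE]
  have hEc : ∀ j : ℕ, 1 ≤ j → j ≤ L + 1 → E (-j) = c j := by
    intro j hj hj'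
    rw [hE]
    simp only
    rw [if_neg (by omega), if_neg (by omega), if_pos (by omega), neg_neg, Int.toNat_natCast]
  have hEs : ∀ j : ℕ, 1 ≤ j → E (-(L + 1 : ℕ) - j) = a j := by
    intro j hj
    rw [hE]
    simp only
    rw [if_neg (by omega), if_neg (by omega), if_neg (by omega), sub_sub_cancel,
      Int.toNat_natCast]
  have hFb : ∀ j : ℕ, 1 ≤ j → F j = b j := by
    intro j hj
    rw [hF]
    simp only
    rw [if_pos (by omega), Int.toNat_natCast]
  have hFd : ∀ j : ℕ, 1 ≤ j → j ≤ L + 1 → F (1 - j) = d j := by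
    intro j hj hj'
    rw [hF]
    simp only
    rw [if_neg (by omega), if_pos (by omega), sub_sub_cancel, Int.toNat_natCast]
  have hFs : ∀ j : ℕ, 1 ≤ j → F (1 - (L + 1 : ℕ) - j) = b j := by
    intro j hj
    rw [hF]
    simp only
    rw [if_neg (by omega), if_neg (by omega), sub_sub_cancel, Int.toNat_natCast]
  have hEpos : ∀ i, 0 < E i := by
    intro i
    rw [hE]
    simp only
    split_ifs with h1 h2 h3
    · exact ha _ (by omega)
    · exact ha _ (by omega)
    · exact hc _ (by omega)
    · exact ha _ (by omega)
  obtain ⟨h, H, hlow⟩ := exists_isTwoSidedCF E F hEpos (-(L + 1 : ℕ)) (fun n => m (n + 1))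
    (fun n => hN _ (by omega)) (fun n => by
      have e1 : F (-(L + 1 : ℕ) - n) = b (n + 1) := by
        rw [← hFs (n + 1) (by omega)]; congr 1; push_cast; ring
      have e2 : E (-(L + 1 : ℕ) - n - 1) = a (n + 1) := by
        rw [← hEs (n + 1) (by omega)]; congr 1; push_cast; ring
      rw [e1, e2]
      filter_upwards [eventually_gt_atTop 0] with y hy
      exact hmul (n + 1) (by omega) y hy)
  have hq : ∀ᶠ y in atTop, Polynomial.aeval (ray y) A * m 1 y ^ 2
      + Polynomial.aeval (ray y) B * m 1 y + Polynomial.aeval (ray y) C = 0 := by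
    filter_upwards [eventually_gt_atTop 0] with y hy
    rw [hm1 y hy]
    exact hMq _ (by rwa [ray_im])
  have hqt : ∀ᶠ y in atTop, Polynomial.aeval (ray y) A * Mt (ray y) ^ 2
      + Polynomial.aeval (ray y) B * Mt (ray y) + Polynomial.aeval (ray y) C = 0 := by
    filter_upwards [eventually_gt_atTop 0, eventually_aeval_ray_ne_zero hA] with y hy hy'
    rw [hMt _ (by rwa [ray_im]) hy', sub_self, mul_zero]
  -- Vieta's relation for the sum of the two roots
  have hsum : ∀ᶠ y in atTop, Polynomial.aeval (ray y) A * (Mt (ray y) + m 1 y)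
      = -Polynomial.aeval (ray y) B := by
    filter_upwards [eventually_gt_atTop 0, eventually_aeval_ray_ne_zero hA] with y hy hy'
    have h0 := hMt _ (by rwa [ray_im]) hy' 0
    have h1 := hMt _ (by rwa [ray_im]) hy' 1
    rw [hm1 y hy]
    linear_combination h1 - h0
  have hMt0 : ∀ᶠ y in atTop, Mt (ray y) ≠ 0 := by
    have h0 := mt (irrational ha hN hmul (P := A) (Q := B)) (fun h => hA h.1)
    filter_upwards [not_frequently.1 h0, hsum] with y h1 h2 h3
    rw [h3] at h2
    exact h1 (by linear_combination h2)
  have hak : (a (k + 1) : ℂ) ≠ 0 := by exact_mod_cast (ha (k + 1) (by omega)).ne'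
  have hden : ∀ᶠ y in atTop, Polynomial.aeval (ray y) (orthPoly c d L)
      * (1 / ((a (k + 1) : ℂ) ^ 2 * Mt (ray y)))
      + Polynomial.aeval (ray y) (secondKindPoly c d L) ≠ 0 := by
    have h0 := mt (irrational ha hN hmul
      (P := -(Polynomial.C (a (k + 1) ^ 2) * secondKindPoly c d L * A))
      (Q := orthPoly c d L * A - Polynomial.C (a (k + 1) ^ 2) * secondKindPoly c d L * B)) (by
        rintro ⟨h1, h2⟩
        have h3 : Polynomial.C (a (k + 1) ^ 2) * secondKindPoly c d L = 0 := by
          simpa [hA] using h1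
        rw [h3, zero_mul, sub_zero] at h2
        exact mul_ne_zero (orthPoly_ne_zero d hc L) hA h2)
    filter_upwards [not_frequently.1 h0, hsum, hMt0] with y h1 h2 h3 h4
    refine h1 ?_
    have : Polynomial.aeval (ray y) (orthPoly c d L) + (a (k + 1) : ℂ) ^ 2 * Mt (ray y)
      * Polynomial.aeval (ray y) (secondKindPoly c d L) = 0 := by
      field_simp at h4
      linear_combination h4
    simp only [map_mul, map_sub, map_neg, Polynomial.aeval_C, Complex.coe_algebraMap,
      Complex.ofReal_pow]
    linear_combination Polynomial.aeval (ray y) A * this - (a (k + 1) : ℂ) ^ 2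
      * Polynomial.aeval (ray y) (secondKindPoly c d L) * h2
  -- the hypothesis on `M` says that `h 0` is `1 / (a_k² Mt)`
  have hw : ∀ᶠ y in atTop, 1 / ((a (k + 1) : ℂ) ^ 2 * Mt (ray y)) = h 0 y := by
    filter_upwards [eventually_gt_atTop 0, eventually_aeval_ray_ne_zero hA, hMt0, hden,
      (eventually_all_finite (Set.finite_Iic L)).2 fun i _ => H.step (-(i : ℕ))]
      with y hy h1 h2 h3 h4
    have hcL : (c (L + 1) : ℂ) ≠ 0 := by exact_mod_cast (hc (L + 1) (by omega)).ne'
    have hrel' := hrel (ray y) (by rwa [ray_im]) h1 h2 (mul_ne_zero (neg_ne_zero.2 hcL) h3)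
    have e0 : h (-(L + 1 : ℕ)) y = M (ray y) := by
      have := hlow 0
      rw [Nat.cast_zero, sub_zero] at this
      rw [this, ← hm1 y hy]
    refine eq_of_poly_relation (s := fun i => h (-(i : ℕ)) y) hc (L := L) (z := ray y) (d := d)
      (fun i hi => ?_) ?_
    · have e1 : F (-(i : ℕ)) = d (i + 1) := by
        rw [← hFd (i + 1) (by omega) (by omega)]; congr 1; push_cast; ring
      have e2 : E (-(i : ℕ) - 1) = c (i + 1) := by
        rw [← hEc (i + 1) (by omega) (by omega)]; congr 1; push_cast; ring
      have e3 : (-((i + 1 : ℕ) : ℤ)) = -(i : ℕ) - 1 := by push_cast; ring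
      have := h4 i hi
      rw [e1, e2] at this
      simp only [e3]
      exact this
    · simp only [e0]
      rw [Nat.add_sub_cancel, eq_div_iff (mul_ne_zero (neg_ne_zero.2 hcL) h3)] at hrel'
      linear_combination -hrel'
  have hh0 : ∀ i, ∀ᶠ y in atTop, h i y ≠ 0 := fun i =>
    (H.step i).mono fun y hy => left_ne_zero_of_mul_eq_one hy
  have hEne : ∀ i, (E i : ℂ) ≠ 0 := fun i => by exact_mod_cast (hEpos i).ne'
  -- the conjugate tails
  obtain ⟨w, hw_def⟩ : ∃ w : ℕ → ℝ → ℂ, w = fun (j : ℕ) y => 1 / ((E ((j : ℤ) - 1) : ℂ) ^ 2 *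
    h ((j : ℤ) - 1) y) := ⟨_, rfl⟩
  have hw1 : ∀ᶠ y in atTop, w 1 y = Mt (ray y) := by
    filter_upwards [hw, hMt0] with y h1 h2
    simp only [hw_def, Nat.cast_one, sub_self, hE0, ← h1]
    field_simp
  have hwmul : ∀ j, 1 ≤ j → ∀ᶠ y in atTop,
      w j y * ((b j : ℂ) - ray y - (a j : ℂ) ^ 2 * w (j + 1) y) = 1 := by
    intro j hj
    filter_upwards [H.step j, hh0 j, hh0 (j - 1)] with y h1 h2 h3
    have h4 := hEne j
    have h5 := hEne (j - 1)
    simp only [hw_def, Nat.cast_add, Nat.cast_one, add_sub_cancel_right]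
    rw [hFb j hj] at h1
    rw [← hEa j hj]
    field_simp
    linear_combination h1
  have hconj : ∀ᶠ y in atTop, w (k + 1) y = w (k + p + 1) y := by
    refine conjugate_tails_eq ha hN hmul hwmul hA hq ?_ ?_
    · filter_upwards [hqt, hw1] with y h1 h2
      rwa [h2]
    · filter_upwards [eventually_gt_atTop 0] with y hy
      rw [add_right_comm k p 1]
      exact (hmper (k + 1) p (by omega) hper' y hy).symm
  obtain ⟨hEk, hhk⟩ := (H.normalized (k + p)).eq_of_sq_mul_eq (H.normalized k) (hEpos (k + p))
    (hEpos k) (by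
      filter_upwards [hconj] with y hy
      simp only [hw_def, Nat.cast_add, Nat.cast_one, add_sub_cancel_right, one_div] at hy
      exact (inv_injective hy).symm)
  have hco := H.coeff_eq hhk
  refine isDoublyPalindromic_of_symmetric hp (E := E) (F := F) (L := L + 1) (fun i => ?_)
    (fun i => ?_) hEa hFb hEs hFs
  · rcases lt_trichotomy i (k + p) with hi | rfl | hi
    · have := (hco (k + p - 1 - i).toNat).2
      rw [Int.toNat_of_nonneg (by omega)] at this
      rw [show i - p = k - 1 - (k + p - 1 - i) by ring, ← this]
      congr 1; ring
    · rw [add_sub_cancel_right]; exact hEk.symm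
    · obtain ⟨n, rfl⟩ : ∃ n : ℕ, i = ((n + p : ℕ) : ℤ) := ⟨(i - p).toNat, by omega⟩
      rw [hEa _ (by omega), (hper' n (by omega)).1, ← hEa n (by omega)]
      congr 1; push_cast; ring
  · rcases le_or_gt i (k + p) with hi | hi
    · have := (hco (k + p - i).toNat).1
      rw [Int.toNat_of_nonneg (by omega)] at this
      rw [show i - p = k - (k + p - i) by ring, ← this]
      congr 1; ring
    · obtain ⟨n, rfl⟩ : ∃ n : ℕ, i = ((n + p : ℕ) : ℤ) := ⟨(i - p).toNat, by omega⟩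
      rw [hFb _ (by omega), (hper' n (by omega)).2, ← hFb n (by omega)]
      congr 1; push_cast; ring
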